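/- For integers $n\ge 2$ and $M\ge 1$ let $$\delta_n(M)=\frac{\#\{m\in\{1,2,\dots,M\}:\Gamma^{(n)}(m)\text{ is transcendental}\}}{M}$$ be the proportion of those $m\in\{1,\dots,M\}$ at which the $n$-th derivative of the Gamma function is transcendental (over $\mathbb{Q}$), and let $$\beta_n(M)=1-\frac{\min\{n-1,M\}}{M}.$$ Then, for every fixed $n\ge 2$, $\delta_n(M)\ge\beta_n(M)$ for all $M\ge 1$. Moreover, as $M\to\infty$, $\beta_n(M)$ is asymptotic to $1-\frac{n-1}{M}$, that is, $\beta_n(M)\sim 1-\frac{n-1}{M}$ (ratio tending to $1$) and so, in particular, the two are of the same order of magnitude, and $\beta_n(M)\to 1$. -/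

import Mathlib

open Filter Topology Asymptotics

/-- The `n`-th derivative `Γ⁽ⁿ⁾(x)` of the (real) Gamma function. -/
noncomputable def gammaDeriv (n : ℕ) (x : ℝ) : ℝ :=
  iteratedDeriv n Real.Gamma x

/-- The lattice `{1, 2, …, M}`. -/
def lattice (M : ℕ) : Set ℕ :=
  Set.Icc 1 M

/-- The density `δ_n(M)` of those `m ∈ {1, …, M}` for which `Γ⁽ⁿ⁾(m)` is transcendental. -/
noncomputable def transDensity (n M : ℕ) : ℝ :=
  ({m ∈ lattice M | Transcendental ℚ (gammaDeriv n (m : ℝ))}.ncard : ℝ) / (M : ℝ)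

/-- The lower bound `β_n(M) = 1 - min {n - 1, M} / M`. -/
noncomputable def betaBound (n M : ℕ) : ℝ :=
  1 - min ((n : ℝ) - 1) (M : ℝ) / (M : ℝ)

/-! It suffices that fewer than `n` integers `m ≥ 1` give algebraic `Γ⁽ⁿ⁾(m)`. Put `γ_j =
Γ⁽ʲ⁾(1)/j!`. Since `Γ(t+m+1) = m! R_m(t) Γ(t+1)` with `R_m = normalizedRising m`, each `Γ⁽ⁿ⁾(m+1)`
is a rational combination of `γ_0 = 1, γ_1, …, γ_n` (`gammaDeriv_natCast_succ`). For `n` distinct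
values of `m` the matrix of coefficients of `R_m` in degrees below `n` is invertible
(`exists_sum_coeff_normalizedRising_eq`, by Descartes' rule of signs), so `n` algebraic values would
make `Γ'(1)` and `Γ''(1)` algebraic. The reflection formula gives `Γ''(1) - Γ'(1)² = π²/6`,
contradicting the transcendence of `π`, which is proved by Lindemann's method. -/

/-! ### Transcendence of `π`. -/

section PiTranscendental

open Polynomial

variable {L : Type*} [Field L] [Algebra ℚ L] [IsGalois ℚ L]

/-- Galois invariance makes the sum rational, and the power of `a` makes it integral. -/
theorem exists_int_eq_pow_smul_sum_aeval (B : Multiset L)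
    (hB : ∀ σ : L ≃ₐ[ℚ] L, B.map σ = B) (a : ℤ) (ha : ∀ β ∈ B, IsIntegral ℤ (a • β))
    (g : ℤ[X]) (m : ℕ) (hg : g.natDegree ≤ m) :
    ∃ z : ℤ, a ^ m • (B.map fun β => aeval β g).sum = (z : L) := by
  have hfix : ∀ σ : L ≃ₐ[ℚ] L, σ (a ^ m • (B.map fun β => aeval β g).sum) =
      a ^ m • (B.map fun β => aeval β g).sum := by
    intro σ
    rw [map_zsmul, map_multiset_sum, Multiset.map_map]
    congr 2
    conv_rhs => rw [← hB σ, Multiset.map_map]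
    refine Multiset.map_congr rfl fun β _ => ?_
    simpa using (aeval_algHom_apply (σ.toAlgHom.restrictScalars ℤ) β g).symm
  obtain ⟨q, hq⟩ := (InfiniteGalois.mem_range_algebraMap_iff_fixed _).2 hfix
  have hint : IsIntegral ℤ (a ^ m • (B.map fun β => aeval β g).sum) := by
    rw [Multiset.smul_sum, Multiset.map_map]
    refine IsIntegral.multiset_sum fun x hx => ?_
    obtain ⟨β, hβ, rfl⟩ := Multiset.mem_map.1 hx
    simp only [Function.comp_apply, aeval_eq_sum_range, Finset.smul_sum]
    refine IsIntegral.sum _ fun i hi => ?_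
    have him : i ≤ m := (Nat.lt_succ_iff.1 (Finset.mem_range.1 hi)).trans hg
    have : a ^ m • g.coeff i • β ^ i = (a ^ (m - i) * g.coeff i) • (a • β) ^ i := by
      rw [_root_.smul_pow, smul_smul, smul_smul]
      congr 1
      rw [mul_right_comm, ← pow_add, Nat.sub_add_cancel him]
    rw [this]
    exact ((ha β hβ).pow i).smul _
  rw [← hq] at hint ⊢
  have : IsIntegral ℤ q := (isIntegral_algebraMap_iff (algebraMap ℚ L).injective).1 hint
  obtain ⟨z, rfl⟩ := IsIntegrallyClosed.isIntegral_iff.1 this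
  exact ⟨z, by simp⟩

theorem exists_int_polynomial_aroots_eq (ι : L →+* ℂ) (B : Multiset L)
    (hB : ∀ σ : L ≃ₐ[ℚ] L, B.map σ = B) (h0 : (0 : L) ∉ B) :
    ∃ F : ℤ[X], F.eval 0 ≠ 0 ∧ F.aroots ℂ = B.map ι ∧ F ≠ 0 ∧ ∀ β ∈ B, aeval β F = 0 := by
  set Q : L[X] := (B.map fun β => X - C β).prod with hQ
  have hfix : ∀ σ : L ≃ₐ[ℚ] L, Q.map (σ : L →+* L) = Q := by
    intro σ
    rw [hQ, Polynomial.map_multiset_prod, Multiset.map_map]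
    conv_rhs => rw [← hB σ, Multiset.map_map]
    congr 1
    exact Multiset.map_congr rfl fun β _ => by simp
  have hlift : Q ∈ Polynomial.lifts (algebraMap ℚ L) := by
    rw [lifts_iff_coeff_lifts]
    intro n
    refine (InfiniteGalois.mem_range_algebraMap_iff_fixed _).2 fun σ => ?_
    conv_rhs => rw [← hfix σ]
    simp
  obtain ⟨Q0, hQ0⟩ := (mem_lifts _).1 hlift
  have hQm : Q.Monic := monic_multisetProd_X_sub_C B
  obtain ⟨b, hb, hF⟩ := IsLocalization.integerNormalization_spec (nonZeroDivisors ℤ) Q0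
  set F := IsLocalization.integerNormalization (nonZeroDivisors ℤ) Q0 with hFdef
  have hb0 : b ≠ 0 := nonZeroDivisors.ne_zero hb
  have hFL : F.map (algebraMap ℤ L) = C (b : L) * Q := by
    rw [IsScalarTower.algebraMap_eq ℤ ℚ L, ← Polynomial.map_map, hF, ← hQ0]
    rw [zsmul_eq_mul]; simp
  have hbL : (b : L) ≠ 0 := by
    have : CharZero L := algebraRat.charZero L
    exact_mod_cast hb0
  have hFC : F.map (algebraMap ℤ ℂ) = C (b : ℂ) * Q.map ι := by
    have : algebraMap ℤ ℂ = ι.comp (algebraMap ℤ L) := RingHom.ext_int _ _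
    rw [this, ← Polynomial.map_map, hFL]
    simp
  have hae : ∀ β : L, aeval β F = b * Q.eval β := by
    intro β
    rw [aeval_def, ← eval_map, hFL, eval_mul, eval_C]
  refine ⟨F, ?_, ?_, ?_, ?_⟩
  · intro h
    have h1 : aeval (0 : L) F = 0 := by
      have := aeval_algebraMap_apply_eq_algebraMap_eval (A := L) (0 : ℤ) F
      rw [h] at this
      simpa using this
    rw [hae] at h1
    have h2 : Q.eval 0 = 0 := (mul_eq_zero.1 h1).resolve_left hbL
    rw [hQ, eval_multiset_prod, Multiset.map_map, Multiset.prod_eq_zero_iff] at h2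
    obtain ⟨β, hβ, hβ0⟩ := Multiset.mem_map.1 h2
    simp only [Function.comp_apply, eval_sub, eval_X, eval_C, zero_sub, neg_eq_zero] at hβ0
    exact h0 (hβ0 ▸ hβ)
  · have : Q.map ι = ((B.map ι).map fun β => X - C β).prod := by
      rw [hQ, Polynomial.map_multiset_prod, Multiset.map_map, Multiset.map_map]
      congr 1
      exact Multiset.map_congr rfl fun β _ => by simp
    rw [aroots, hFC, roots_C_mul _ (by exact_mod_cast hb0), this, roots_multiset_prod_X_sub_C]
  · intro h
    rw [h, Polynomial.map_zero] at hFL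
    exact (mul_ne_zero (C_ne_zero.2 hbL) hQm.ne_zero) hFL.symm
  · intro β hβ
    rw [hae, hQ, eval_multiset_prod, Multiset.map_map]
    rw [Multiset.prod_eq_zero, mul_zero]
    exact Multiset.mem_map.2 ⟨β, hβ, by simp⟩

theorem tendsto_const_mul_pow_div_factorial_pred (A K : ℝ) :
    Tendsto (fun p : ℕ => A * K ^ p / ((p - 1).factorial : ℝ)) atTop (𝓝 0) := by
  have h := ((FloorSemiring.tendsto_pow_div_factorial_atTop K).comp
    (tendsto_sub_atTop_nat 1)).const_mul (A * K)
  rw [mul_zero] at h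
  refine h.congr' ?_
  filter_upwards [eventually_ge_atTop 1] with p hp
  obtain ⟨q, rfl⟩ := Nat.exists_eq_add_of_le' hp
  simp only [Function.comp_apply, Nat.add_sub_cancel, pow_succ]
  ring

/-- Hermite's argument: simultaneous approximation of the `exp β` turns a vanishing sum into an
integer that is nonzero modulo a large prime yet smaller than 1 in absolute value. -/
theorem natCast_add_sum_exp_ne_zero (ι : L →+* ℂ) (B : Multiset L)
    (hB : ∀ σ : L ≃ₐ[ℚ] L, B.map σ = B) (h0 : (0 : L) ∉ B) (k : ℕ) (hk : 0 < k) :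
    (k : ℂ) + (B.map fun β => Complex.exp (ι β)).sum ≠ 0 := by
  intro hsum
  obtain ⟨F, hF0, hroots, hF, hFB⟩ := exists_int_polynomial_aroots_eq ι B hB h0
  obtain ⟨c, hc⟩ := LindemannWeierstrass.exp_polynomial_approx F hF0
  set a := F.leadingCoeff with ha
  have ha0 : a ≠ 0 := leadingCoeff_ne_zero.2 hF
  have hint : ∀ β ∈ B, IsIntegral ℤ (a • β) := fun β hβ =>
    isIntegral_leadingCoeff_smul F β (hFB β hβ)
  have hlim := tendsto_const_mul_pow_div_factorial_pred (Multiset.card B)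
    ((|a| : ℤ) ^ F.natDegree * c)
  -- Exceeding `|F(0)|` admits `p` in the approximation; exceeding `k` and `|a|` makes `p` prime to
  -- both.
  obtain ⟨p, hp, hp1, hlt⟩ : ∃ p : ℕ, p.Prime ∧ (eval 0 F).natAbs + k + a.natAbs < p ∧
      Multiset.card B * (((|a| : ℤ) : ℝ) ^ F.natDegree * c) ^ p / ((p - 1).factorial : ℝ) < 1 := by
    obtain ⟨N, hN⟩ := eventually_atTop.1 (hlim.eventually_lt_const one_pos)
    obtain ⟨p, hpN, hp⟩ := Nat.exists_infinite_primes
      (N + ((eval 0 F).natAbs + k + a.natAbs + 1))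
    exact ⟨p, hp, by omega, hN p (by omega)⟩
  obtain ⟨n, hpn, g, hgdeg, hg⟩ := hc p (by omega) hp
  obtain ⟨z, hz⟩ := exists_int_eq_pow_smul_sum_aeval B hB a hint g (p * F.natDegree)
    (hgdeg.trans (Nat.sub_le _ _))
  have hzC : (a : ℂ) ^ (p * F.natDegree) * (B.map fun β => aeval (ι β) g).sum = (z : ℂ) := by
    have := congrArg ι hz
    rw [map_zsmul, map_multiset_sum, Multiset.map_map, map_intCast, zsmul_eq_mul] at this
    rw [← this]
    push_cast
    congr 3
    ext β
    simpa using aeval_algHom_apply (ι.toIntAlgHom) β g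
  set N : ℤ := a ^ (p * F.natDegree) * (n * k) + p * z with hN
  have hNp : ¬ (p : ℤ) ∣ N := by
    have hpi : Prime (p : ℤ) := Nat.prime_iff_prime_int.1 hp
    rw [hN, dvd_add_left (dvd_mul_right _ _)]
    intro h
    rcases hpi.dvd_or_dvd h with h | h
    · have := Int.natCast_dvd.1 (hpi.dvd_of_dvd_pow h)
      have := Nat.le_of_dvd (Int.natAbs_pos.2 ha0) this
      omega
    · rcases hpi.dvd_or_dvd h with h | h
      · exact hpn h
      · have := Nat.le_of_dvd hk (Int.natCast_dvd_natCast.1 h)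
        omega
  have hN0 : N ≠ 0 := by
    rintro h
    exact hNp (h ▸ dvd_zero _)
  have hE : (B.map fun β => n • Complex.exp (ι β) - p • aeval (ι β) g).sum =
      -(n * k) - p * (B.map fun β => aeval (ι β) g).sum := by
    simp only [zsmul_eq_mul, nsmul_eq_mul]
    rw [Multiset.sum_map_sub, Multiset.sum_map_mul_left, Multiset.sum_map_mul_left,
      eq_neg_of_add_eq_zero_right hsum]
    ring
  have hEN : (a : ℂ) ^ (p * F.natDegree) *
      (B.map fun β => n • Complex.exp (ι β) - p • aeval (ι β) g).sum = -(N : ℂ) := by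
    rw [hE, hN]
    push_cast
    rw [← hzC]
    ring
  have hbound : ‖(B.map fun β => n • Complex.exp (ι β) - p • aeval (ι β) g).sum‖ ≤
      Multiset.card B * (c ^ p / ((p - 1).factorial : ℝ)) := by
    have : ∀ S : Multiset L, S ≤ B →
        ‖(S.map fun β => n • Complex.exp (ι β) - p • aeval (ι β) g).sum‖ ≤
        Multiset.card S * (c ^ p / ((p - 1).factorial : ℝ)) := by
      intro S
      induction S using Multiset.induction_on with
      | empty => simp
      | cons x S ih =>
        intro hS
        rw [Multiset.map_cons, Multiset.sum_cons, Multiset.card_cons, Nat.cast_succ, add_mul,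
          one_mul]
        have hx : x ∈ B := Multiset.mem_of_le hS (Multiset.mem_cons_self _ _)
        refine (norm_add_le _ _).trans ?_
        rw [add_comm]
        refine add_le_add (ih ((Multiset.le_cons_self _ _).trans hS)) (hg ?_)
        rw [hroots]
        exact Multiset.mem_map_of_mem _ hx
    exact this B le_rfl
  have h1 : (1 : ℝ) ≤ ‖(N : ℂ)‖ := by
    rw [Complex.norm_intCast]
    exact_mod_cast Int.one_le_abs hN0
  rw [← norm_neg, ← hEN, norm_mul, norm_pow, Complex.norm_intCast] at h1
  have h2 := h1.trans (mul_le_mul_of_nonneg_left hbound (by positivity))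
  refine absurd h2 (not_le.2 (lt_of_eq_of_lt ?_ hlt))
  push_cast
  rw [mul_pow, ← pow_mul, mul_comm p]
  ring

/-- Otherwise `∏ (1 + exp x)` over `s` vanishes; expanded, it is a sum of exponentials of subset
sums, a Galois-stable multiset. -/
theorem exp_ne_neg_one_of_galois_stable (ι : L →+* ℂ) (s : Finset L)
    (hs : ∀ σ : L ≃ₐ[ℚ] L, ∀ x, σ x ∈ s ↔ x ∈ s) (z : L) (hz : z ∈ s) :
    Complex.exp (ι z) ≠ -1 := by
  classical
  intro hexp
  set B₀ : Multiset L := s.powerset.val.map fun t => ∑ x ∈ t, x with hB₀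
  have hB₀σ : ∀ σ : L ≃ₐ[ℚ] L, B₀.map σ = B₀ := by
    intro σ
    have hpow : s.powerset.map (Finset.mapEmbedding σ.toEquiv.toEmbedding).toEmbedding =
        s.powerset := by
      have hsmap : s.map σ.toEquiv.toEmbedding = s := by
        ext x
        rw [Finset.mem_map_equiv, ← hs σ]
        simp
      conv_rhs => rw [← hsmap, Finset.map_eq_image, Finset.powerset_image]
      rw [Finset.map_eq_image]
      exact Finset.image_congr fun t _ => by simp [Finset.map_eq_image]
    conv_rhs => rw [hB₀, ← hpow]
    rw [hB₀, Finset.map_val, Multiset.map_map, Multiset.map_map]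
    exact Multiset.map_congr rfl fun t _ => by simp [map_sum]
  have hprod : ∏ x ∈ s, (1 + Complex.exp (ι x)) = 0 :=
    Finset.prod_eq_zero hz (by rw [hexp]; ring)
  have hsum : (B₀.map fun β => Complex.exp (ι β)).sum = 0 := by
    rw [← hprod, Finset.prod_one_add, hB₀, Multiset.map_map]
    change ∑ t ∈ s.powerset, _ = _
    refine Finset.sum_congr rfl fun t _ => ?_
    simp [Complex.exp_sum]
  -- Zero subset sums each contribute 1 to `k`; the empty subset ensures `k > 0`.
  refine natCast_add_sum_exp_ne_zero ι (B₀.filter (· ≠ 0)) (fun σ => ?_) (by simp)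
    (Multiset.card (B₀.filter (· = 0))) ?_ ?_
  · conv_rhs => rw [← hB₀σ σ, Multiset.filter_map]
    congr 1
    exact Multiset.filter_congr fun x _ => by simp
  · rw [Multiset.card_pos_iff_exists_mem]
    exact ⟨0, Multiset.mem_filter.2 ⟨Multiset.mem_map.2 ⟨∅, by simp, by simp⟩, rfl⟩⟩
  · rw [← hsum]
    conv_rhs => rw [← Multiset.filter_add_not (· = 0) B₀]
    rw [Multiset.map_add, Multiset.sum_add]
    congr 1
    rw [Multiset.map_congr (g := fun _ => (1 : ℂ)) rfl]
    · simp
    · intro x hx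
      simp [(Multiset.mem_filter.1 hx).2]

theorem exp_ne_neg_one_of_isGalois (ι : L →+* ℂ) (z : L) : Complex.exp (ι z) ≠ -1 := by
  classical
  have hzint : IsIntegral ℚ z := Algebra.IsIntegral.isIntegral z
  refine exp_ne_neg_one_of_galois_stable ι ((minpoly ℚ z).aroots L).toFinset (fun σ x => ?_) z ?_
  · have := aeval_algHom_apply σ.toAlgHom x (minpoly ℚ z)
    rw [AlgEquiv.coe_toAlgHom] at this
    simp [minpoly.ne_zero hzint, this]
  · simp [minpoly.ne_zero hzint]

theorem isGalois_algebraicClosure (F E : Type*) [Field F] [Field E] [CharZero F] [Algebra F E]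
    [IsAlgClosed E] : IsGalois F (algebraicClosure F E) :=
  have : Normal F (algebraicClosure F E) := IsAlgClosure.normal F _
  ⟨⟩

theorem transcendental_pi : Transcendental ℚ Real.pi := by
  intro hpi
  have hpiC : IsAlgebraic ℚ (Real.pi : ℂ) := by
    simpa using hpi.algebraMap (A := ℂ)
  have hI : IsAlgebraic ℚ Complex.I := Complex.isIntegral_rat_I.isAlgebraic
  exact @exp_ne_neg_one_of_isGalois (algebraicClosure ℚ ℂ) _ _ (isGalois_algebraicClosure ℚ ℂ)
    (algebraMap _ _) ⟨Real.pi * Complex.I, mem_algebraicClosure_iff.2 (hpiC.mul hI)⟩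
    Complex.exp_pi_mul_I

end PiTranscendental

/-! ### Rising factorials and Descartes' rule of signs. -/

section RisingFactorials

open Polynomial

theorem signVariations_congr {R : Type*} [Semiring R] [LinearOrder R] {p q : R[X]}
    (h : ∀ m, SignType.sign (p.coeff m) = SignType.sign (q.coeff m)) :
    p.signVariations = q.signVariations := by
  have hsupp : p.support = q.support := by
    ext m
    rw [mem_support_iff, mem_support_iff, ← sign_ne_zero (a := p.coeff m), h, sign_ne_zero]
  have hdeg : p.degree = q.degree := by rw [degree, degree, hsupp]
  have hlist : p.coeffList.map SignType.sign = q.coeffList.map SignType.sign := by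
    simp only [coeffList, hdeg, List.map_map]
    exact List.map_congr_left fun m _ => h m
  simp only [signVariations, hlist]

/-- Erasing the leading term removes one monomial and at most one variation. -/
theorem signVariations_lt_card_support {R : Type*} [Semiring R] [LinearOrder R] {p : R[X]}
    (hp : p ≠ 0) : p.signVariations < p.support.card := by
  induction hn : p.support.card generalizing p with
  | zero => simp_all
  | succ n ih =>
    have hcard := card_support_eraseLead_add_one hp
    by_cases h0 : p.eraseLead = 0
    · have hmono : p = monomial p.natDegree p.leadingCoeff := by
        conv_lhs => rw [← eraseLead_add_monomial_natDegree_leadingCoeff p, h0, zero_add]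
      rw [hmono, signVariations_monomial]
      omega
    · have := ih h0 (by omega)
      have := signVariations_le_eraseLead_succ p
      omega

/-- The normalized shifted rising factorial `∏ j ≤ m, (1 + t / j)`. -/
noncomputable def normalizedRising (m : ℕ) : ℚ[X] :=
  ∏ j ∈ Finset.range m, (1 + C ((j + 1 : ℚ)⁻¹) * X)

theorem normalizedRising_succ (m : ℕ) :
    normalizedRising (m + 1) =
      normalizedRising m + X * (C ((m + 1 : ℚ)⁻¹) * normalizedRising m) := by
  rw [normalizedRising, Finset.prod_range_succ, ← normalizedRising]
  ring

/-- The linear map sending `X ^ m` to `normalizedRising m`. -/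
noncomputable def risingMap : ℚ[X] →ₗ[ℚ] ℚ[X] :=
  (basisMonomials ℚ).constr ℚ normalizedRising

/-- The linear map dividing the `m`-th coefficient by `m + 1`. -/
noncomputable def harmonicWeight : ℚ[X] →ₗ[ℚ] ℚ[X] :=
  (basisMonomials ℚ).constr ℚ fun m => monomial m ((m + 1 : ℚ)⁻¹)

theorem risingMap_monomial (m : ℕ) (c : ℚ) :
    risingMap (monomial m c) = C c * normalizedRising m := by
  have h : (monomial m c : ℚ[X]) = c • basisMonomials ℚ m := by simp [smul_monomial]
  rw [h, map_smul, risingMap, Module.Basis.constr_basis, smul_eq_C_mul]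

theorem harmonicWeight_monomial (m : ℕ) (c : ℚ) :
    harmonicWeight (monomial m c) = monomial m (c * (m + 1 : ℚ)⁻¹) := by
  have h : (monomial m c : ℚ[X]) = c • basisMonomials ℚ m := by simp [smul_monomial]
  rw [h, map_smul, harmonicWeight, Module.Basis.constr_basis, smul_monomial, smul_eq_mul]

theorem coeff_harmonicWeight (q : ℚ[X]) (m : ℕ) :
    (harmonicWeight q).coeff m = q.coeff m * (m + 1 : ℚ)⁻¹ := by
  induction q using Polynomial.induction_on' with
  | add p q hp hq => rw [map_add, coeff_add, hp, hq, coeff_add, add_mul]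
  | monomial k c =>
    rw [harmonicWeight_monomial, coeff_monomial, coeff_monomial]
    split_ifs with h
    · rw [h]
    · simp

theorem signVariations_harmonicWeight (q : ℚ[X]) :
    (harmonicWeight q).signVariations = q.signVariations := by
  refine signVariations_congr fun m => ?_
  rw [coeff_harmonicWeight, sign_mul, sign_pos (by positivity : (0 : ℚ) < (m + 1 : ℚ)⁻¹), mul_one]

/-- This is the recurrence `R_{m+1} - R_m = X R_m/(m+1)`, extended linearly. -/
theorem risingMap_X_sub_one_mul (q : ℚ[X]) :
    risingMap ((X - C 1) * q) = X * risingMap (harmonicWeight q) := by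
  induction q using Polynomial.induction_on' with
  | add p q hp hq => rw [mul_add, map_add, hp, hq, map_add, map_add, mul_add]
  | monomial k c =>
    rw [harmonicWeight_monomial, sub_mul, X_mul_monomial, C_1, one_mul, map_sub,
      risingMap_monomial, risingMap_monomial, risingMap_monomial, normalizedRising_succ, C_mul]
    ring

theorem coeff_zero_risingMap (p : ℚ[X]) : (risingMap p).coeff 0 = p.eval 1 := by
  induction p using Polynomial.induction_on' with
  | add p q hp hq => rw [map_add, coeff_add, hp, hq, eval_add]
  | monomial k c =>
    rw [risingMap_monomial, coeff_zero_eq_eval_zero, normalizedRising]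
    simp [eval_prod]

/-- Each factor `X` of the image forces a factor `X - 1` of `p`, costing at least one sign
variation; the remaining positive weights preserve signs. -/
theorem signVariations_ge_of_X_pow_dvd_risingMap (n : ℕ) {p : ℚ[X]} (hp : p ≠ 0)
    (h : X ^ n ∣ risingMap p) : n ≤ p.signVariations := by
  induction n generalizing p with
  | zero => exact Nat.zero_le _
  | succ n ih =>
    have h1 : p.eval 1 = 0 := by
      rw [← coeff_zero_risingMap]
      exact X_pow_dvd_iff.1 h 0 n.succ_pos
    obtain ⟨q, rfl⟩ := dvd_iff_isRoot.2 h1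
    have hq : q ≠ 0 := right_ne_zero_of_mul hp
    rw [risingMap_X_sub_one_mul, pow_succ'] at h
    have hW : harmonicWeight q ≠ 0 := by
      intro h0
      apply hq
      ext m
      have := coeff_harmonicWeight q m
      rw [h0, coeff_zero, eq_comm, mul_eq_zero] at this
      exact this.resolve_right (by positivity)
    have := ih hW ((mul_dvd_mul_iff_left X_ne_zero).1 h)
    rw [signVariations_harmonicWeight] at this
    have := succ_signVariations_le_X_sub_C_mul (η := (1 : ℚ)) one_pos hq
    omega

theorem exists_sum_coeff_normalizedRising_eq (s : Finset ℕ) (b : ℕ → ℚ) :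
    ∃ a : ℕ → ℚ, ∀ k < s.card, ∑ m ∈ s, a m * (normalizedRising m).coeff k = b k := by
  let f : (s → ℚ) →ₗ[ℚ] (Fin s.card → ℚ) :=
    { toFun := fun a k => ∑ m : s, a m * (normalizedRising m).coeff k
      map_add' := fun a b => by ext; simp [add_mul, Finset.sum_add_distrib]
      map_smul' := fun c a => by ext; simp [mul_assoc, Finset.mul_sum] }
  have hinj : Function.Injective f := by
    rw [injective_iff_map_eq_zero]
    intro a ha
    by_contra hne
    -- A kernel vector gives a `p` with at most `s.card` terms, hence too few variations for `X ^
    -- s.card` to divide its image.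
    set p : ℚ[X] := ∑ m : s, monomial (m : ℕ) (a m) with hp
    have hcoeff : ∀ m : s, p.coeff m = a m := by
      intro m
      rw [hp, finsetSum_coeff, Finset.sum_eq_single m]
      · simp
      · intro j _ hj
        rw [coeff_monomial, if_neg (fun h => hj (Subtype.ext h))]
      · simp
    have hp0 : p ≠ 0 := by
      intro h0
      apply hne
      ext m
      rw [← hcoeff, h0, coeff_zero, Pi.zero_apply]
    have hsupp : p.support ⊆ s := by
      intro j hj
      by_contra hjs
      rw [mem_support_iff, hp, finsetSum_coeff] at hj
      refine hj (Finset.sum_eq_zero fun m _ => ?_)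
      rw [coeff_monomial, if_neg]
      rintro rfl
      exact hjs m.2
    have hdvd : X ^ s.card ∣ risingMap p := by
      rw [X_pow_dvd_iff]
      intro k hk
      rw [hp, map_sum, finsetSum_coeff]
      simp_rw [risingMap_monomial, coeff_C_mul]
      exact congrFun ha ⟨k, hk⟩
    have h1 := signVariations_ge_of_X_pow_dvd_risingMap _ hp0 hdvd
    have h2 := signVariations_lt_card_support hp0
    have h3 := Finset.card_le_card hsupp
    omega
  have hsurj : Function.Surjective f :=
    (LinearMap.injective_iff_surjective_of_finrank_eq_finrank (by simp)).1 hinj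
  obtain ⟨a, ha⟩ := hsurj fun k => b k
  refine ⟨fun m => if h : m ∈ s then a ⟨m, h⟩ else 0, fun k hk => ?_⟩
  rw [← congrFun ha ⟨k, hk⟩, ← Finset.sum_coe_sort s]
  simp [f]

end RisingFactorials

/-! ### Taylor coefficients of `Γ` at positive integers. -/

section GammaDerivatives

theorem Real.contDiffAt_Gamma {x : ℝ} (hx : 0 < x) (n : ℕ∞) : ContDiffAt ℝ n Real.Gamma x := by
  have hopen : IsOpen {z : ℂ | 0 < z.re} := isOpen_lt continuous_const Complex.continuous_re
  have hdiff : DifferentiableOn ℂ Complex.Gamma {z : ℂ | 0 < z.re} := fun z hz => by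
    refine (Complex.differentiableAt_Gamma z fun m hm => ?_).differentiableWithinAt
    have hz' : 0 < z.re := hz
    rw [hm] at hz'
    simp only [Complex.neg_re, Complex.natCast_re, Left.neg_pos_iff] at hz'
    exact absurd hz' (not_lt.2 m.cast_nonneg)
  have han : AnalyticAt ℂ Complex.Gamma (x : ℂ) :=
    hdiff.analyticAt (hopen.mem_nhds (by simpa using hx))
  have : AnalyticAt ℝ Real.Gamma x := by
    simpa [Complex.Gamma_ofReal] using han.re_ofReal
  exact this.contDiffAt

theorem contDiffAt_Gamma_add_one (n : ℕ) : ContDiffAt ℝ n (fun t => Real.Gamma (t + 1)) 0 := by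
  have h : ContDiffAt ℝ n Real.Gamma ((0 : ℝ) + 1) := Real.contDiffAt_Gamma (by norm_num) n
  exact h.comp (f := fun t : ℝ => t + 1) (0 : ℝ) (by fun_prop)

theorem iteratedDeriv_aeval_zero (p : Polynomial ℚ) (k : ℕ) :
    iteratedDeriv k (fun t : ℝ => Polynomial.aeval t p) 0 = k.factorial * (p.coeff k : ℝ) := by
  have h : ∀ k, iteratedDeriv k (fun t : ℝ => Polynomial.aeval t p) =
      fun t => Polynomial.aeval t (Polynomial.derivative^[k] p) := by
    intro k
    induction k with
    | zero => simp
    | succ k ih =>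
      rw [iteratedDeriv_succ, ih, Function.iterate_succ_apply']
      funext t
      exact Polynomial.deriv_aeval _
  rw [h]
  simp only
  rw [← Polynomial.coeff_zero_eq_aeval_zero', Polynomial.coeff_iterate_derivative]
  simp [Nat.descFactorial_self]

theorem Gamma_add_natCast_eq (m : ℕ) {t : ℝ} (ht : -1 < t) :
    Real.Gamma (t + (m + 1 : ℕ)) =
      m.factorial * Polynomial.aeval t (normalizedRising m) * Real.Gamma (t + 1) := by
  induction m with
  | zero => simp [normalizedRising]
  | succ m ih =>
    have h : t + ((m + 1 + 1 : ℕ) : ℝ) = t + ((m + 1 : ℕ) : ℝ) + 1 := by push_cast; ring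
    have hpos : 0 < t + ((m + 1 : ℕ) : ℝ) := by
      push_cast
      have : (0 : ℝ) ≤ m := m.cast_nonneg
      linarith
    rw [h, Real.Gamma_add_one hpos.ne', ih, normalizedRising_succ, Nat.factorial_succ]
    have : (m + 1 : ℝ) ≠ 0 := by positivity
    simp only [map_add, map_mul, Polynomial.aeval_X, Polynomial.aeval_C]
    push_cast [eq_ratCast]
    field_simp
    ring

theorem gammaDeriv_natCast_succ (n m : ℕ) :
    gammaDeriv n ((m + 1 : ℕ) : ℝ) = m.factorial * n.factorial *
      ∑ k ∈ Finset.range (n + 1), ((normalizedRising m).coeff k : ℝ) *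
        (gammaDeriv (n - k) 1 / (n - k).factorial) := by
  have hshift : ∀ (j : ℕ) (c : ℝ),
      iteratedDeriv j (fun t => Real.Gamma (t + c)) 0 = gammaDeriv j c := fun j c => by
    rw [iteratedDeriv_comp_add_const]
    simp only [zero_add, gammaDeriv]
  have hev : (fun t : ℝ => Real.Gamma (t + ((m + 1 : ℕ) : ℝ))) =ᶠ[𝓝 0] fun t =>
      (m.factorial : ℝ) * (Polynomial.aeval t (normalizedRising m) * Real.Gamma (t + 1)) := by
    filter_upwards [lt_mem_nhds (show (-1 : ℝ) < 0 by norm_num)] with t ht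
    rw [Gamma_add_natCast_eq m ht, mul_assoc]
  rw [← hshift, hev.iteratedDeriv_eq, iteratedDeriv_const_mul_field,
    iteratedDeriv_fun_mul (Polynomial.contDiff_aeval _ _).contDiffAt (contDiffAt_Gamma_add_one n),
    mul_assoc]
  congr 1
  rw [Finset.mul_sum]
  refine Finset.sum_congr rfl fun k hk => ?_
  have hkn : k ≤ n := Nat.lt_succ_iff.1 (Finset.mem_range.1 hk)
  rw [hshift, iteratedDeriv_aeval_zero, ← Nat.choose_mul_factorial_mul_factorial hkn]
  have : ((n - k).factorial : ℝ) ≠ 0 := by positivity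
  push_cast
  field_simp

theorem gammaDeriv_zero_one : gammaDeriv 0 1 = 1 := by simp [gammaDeriv]

/-- Clearing the denominator keeps the identity valid at `t = 0`, where it is differentiated. -/
theorem Gamma_reflection_shifted {t : ℝ} (ht : |t| < 1) :
    Real.Gamma (t + 1) * Real.Gamma (-t + 1) * Real.sin (Real.pi * t) = Real.pi * t := by
  rcases eq_or_ne t 0 with rfl | h0
  · simp
  have hsin : Real.sin (Real.pi * t) ≠ 0 := by
    rw [Real.sin_ne_zero_iff]
    intro k hk
    have hkt : (k : ℝ) = t := by
      have := Real.pi_ne_zero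
      field_simp at hk
      linarith
    rw [← hkt] at ht h0
    have h1 : |k| < 1 := by exact_mod_cast ht
    rw [Int.abs_lt_one_iff] at h1
    exact h0 (by rw [h1, Int.cast_zero])
  rw [Real.Gamma_add_one h0, neg_add_eq_sub, mul_assoc t, Real.Gamma_mul_Gamma_one_sub, mul_assoc,
    div_mul_cancel₀ _ hsin, mul_comm]

theorem gammaDeriv_two_one_sub_sq :
    2 * gammaDeriv 2 1 - 2 * gammaDeriv 1 1 ^ 2 = Real.pi ^ 2 / 3 := by
  have hG : ∀ n : ℕ, ContDiffAt ℝ n (fun t => Real.Gamma (t + 1)) 0 := contDiffAt_Gamma_add_one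
  have hH : ∀ n : ℕ, ContDiffAt ℝ n (fun t => Real.Gamma (-t + 1)) 0 := fun n => by
    have h : ContDiffAt ℝ n Real.Gamma (-(0 : ℝ) + 1) := Real.contDiffAt_Gamma (by norm_num) n
    exact h.comp (f := fun t : ℝ => -t + 1) (0 : ℝ) (by fun_prop)
  have hGd : ∀ j, iteratedDeriv j (fun t => Real.Gamma (t + 1)) 0 = gammaDeriv j 1 := fun j => by
    rw [iteratedDeriv_comp_add_const]
    simp only [zero_add, gammaDeriv]
  have hHd : ∀ j, iteratedDeriv j (fun t => Real.Gamma (-t + 1)) 0 =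
      (-1) ^ j * gammaDeriv j 1 := fun j => by
    rw [iteratedDeriv_comp_neg j (fun t => Real.Gamma (t + 1)), neg_zero, hGd, smul_eq_mul]
  have hS : ∀ j, iteratedDeriv j (fun t => Real.sin (Real.pi * t)) 0 =
      Real.pi ^ j * iteratedDeriv j Real.sin 0 := fun j => by
    rw [iteratedDeriv_comp_const_mul Real.contDiff_sin]
    simp
  have hsc : ∀ n : ℕ, ContDiffAt ℝ n (fun t => Real.sin (Real.pi * t)) 0 := fun n =>
    (Real.contDiff_sin.comp (contDiff_const.mul contDiff_id)).contDiffAt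
  have hev : (fun t => Real.Gamma (t + 1) * Real.Gamma (-t + 1) * Real.sin (Real.pi * t)) =ᶠ[𝓝 0]
      fun t => Real.pi * t := by
    have : Metric.ball (0 : ℝ) 1 ∈ 𝓝 (0 : ℝ) := Metric.ball_mem_nhds 0 one_pos
    filter_upwards [this] with t ht
    exact Gamma_reflection_shifted (by simpa using ht)
  -- The sine has a simple zero at 0, so order 3 reaches the second derivative of `Γ(1+t)Γ(1-t)`.
  have h3 := hev.iteratedDeriv_eq 3
  rw [iteratedDeriv_fun_mul ((hG 3).mul (hH 3)) (hsc 3), iteratedDeriv_const_mul_field] at h3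
  have h2 := iteratedDeriv_fun_mul (hG 2) (hH 2)
  have hs0 : iteratedDeriv 0 Real.sin 0 = 0 := by simp
  have hs1 : iteratedDeriv 1 Real.sin 0 = 1 := by simp
  have hs2 : iteratedDeriv 2 Real.sin 0 = 0 := by simp [iteratedDeriv_succ]
  have hs3 : iteratedDeriv 3 Real.sin 0 = -1 := by simp [iteratedDeriv_succ]
  simp only [Finset.sum_range_succ, Finset.sum_range_zero, hGd, hHd, gammaDeriv_zero_one] at h2
  simp only [Finset.sum_range_succ, Finset.sum_range_zero, hS, hs0, hs1, hs2, hs3] at h3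
  norm_num [gammaDeriv_zero_one, Nat.choose] at h2 h3
  rw [h2, iteratedDeriv_fun_id_zero, if_neg (by norm_num), mul_zero] at h3
  have hpi := Real.pi_ne_zero
  apply mul_left_cancel₀ (mul_ne_zero three_ne_zero hpi)
  linear_combination h3

end GammaDerivatives

/-! ### Bounding the number of algebraic values. -/

section AlgebraicValues

theorem isAlgebraic_gammaDeriv_one_of_card_eq {n : ℕ} {s : Finset ℕ} (hs : s.card = n)
    (halg : ∀ m ∈ s, IsAlgebraic ℚ (gammaDeriv n ((m + 1 : ℕ) : ℝ))) {j : ℕ} (hj0 : 0 < j)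
    (hj : j ≤ n) : IsAlgebraic ℚ (gammaDeriv j 1) := by
  -- These weights isolate `γ_j` among the columns `k < n`; the column `k = n` multiplies `γ_0 = 1`
  -- and leaves the rational `c`.
  obtain ⟨a, ha⟩ := exists_sum_coeff_normalizedRising_eq s fun k => if k = n - j then 1 else 0
  rw [hs] at ha
  have hq : ∀ q : ℚ, IsAlgebraic ℚ (q : ℝ) := fun q => by
    simpa using isAlgebraic_algebraMap (A := ℝ) q
  set c : ℚ := ∑ m ∈ s, a m * (normalizedRising m).coeff n with hc
  have key : gammaDeriv j 1 = j.factorial * (∑ m ∈ s, ((a m / (m.factorial * n.factorial) : ℚ) : ℝ)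
      * gammaDeriv n ((m + 1 : ℕ) : ℝ) - c) := by
    have h1 : ∀ m ∈ s, ((a m / (m.factorial * n.factorial) : ℚ) : ℝ) *
        gammaDeriv n ((m + 1 : ℕ) : ℝ) = ∑ k ∈ Finset.range (n + 1),
          ((a m * (normalizedRising m).coeff k : ℚ) : ℝ) *
            (gammaDeriv (n - k) 1 / (n - k).factorial) := by
      intro m _
      have hm : (m.factorial : ℝ) ≠ 0 := by positivity
      have hn : (n.factorial : ℝ) ≠ 0 := by positivity
      rw [gammaDeriv_natCast_succ, ← mul_assoc, Finset.mul_sum]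
      refine Finset.sum_congr rfl fun k _ => ?_
      rw [← mul_assoc]
      congr 1
      push_cast
      field_simp
    rw [Finset.sum_congr rfl h1, Finset.sum_comm]
    simp_rw [← Finset.sum_mul, ← Rat.cast_sum]
    rw [Finset.sum_range_succ, ← hc, Finset.sum_congr rfl (fun k hk => by
      rw [ha k (Finset.mem_range.1 hk)]), Finset.sum_eq_single (n - j)]
    · rw [Nat.sub_self, gammaDeriv_zero_one, Nat.sub_sub_self hj]
      have : (j.factorial : ℝ) ≠ 0 := by positivity
      simp
      field_simp
    · intro k _ hk
      simp [hk]
    · intro h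
      exact absurd (Finset.mem_range.2 (by omega)) h
  rw [key]
  have hmem : ∑ m ∈ s, ((a m / (m.factorial * n.factorial) : ℚ) : ℝ) *
      gammaDeriv n ((m + 1 : ℕ) : ℝ) ∈ algebraicClosure ℚ ℝ :=
    sum_mem fun m hm => mul_mem (mem_algebraicClosure_iff.2 (hq _))
      (mem_algebraicClosure_iff.2 (halg m hm))
  exact (by simpa using hq j.factorial : IsAlgebraic ℚ (j.factorial : ℝ)).mul
    ((mem_algebraicClosure_iff.1 hmem).sub (hq c))

theorem card_lt_of_forall_isAlgebraic {n : ℕ} (hn : 2 ≤ n) {s : Finset ℕ}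
    (halg : ∀ m ∈ s, IsAlgebraic ℚ (gammaDeriv n ((m + 1 : ℕ) : ℝ))) : s.card < n := by
  by_contra! hcard
  obtain ⟨t, hts, ht⟩ := Finset.exists_subset_card_eq hcard
  have h := fun j => isAlgebraic_gammaDeriv_one_of_card_eq (j := j) ht fun m hm => halg m (hts hm)
  have h1 := h 1 one_pos (by omega)
  have h2 := h 2 two_pos hn
  have h6 : Real.pi ^ 2 = 3 * (2 * gammaDeriv 2 1 - 2 * gammaDeriv 1 1 ^ 2) := by
    rw [gammaDeriv_two_one_sub_sq]
    ring
  refine transcendental_pi (IsAlgebraic.of_pow two_pos (h6 ▸ ?_))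
  have hnat : ∀ k : ℕ, IsAlgebraic ℚ (k : ℝ) := fun k => isAlgebraic_natCast k
  exact (hnat 3).mul (((hnat 2).mul h2).sub ((hnat 2).mul (h1.pow 2)))

end AlgebraicValues

/-! ### Density bound and asymptotics. -/

section Density

theorem betaBound_le_transDensity {n M : ℕ} (hn : 2 ≤ n) (hM : 1 ≤ M) :
    betaBound n M ≤ transDensity n M := by
  classical
  have hM0 : (0 : ℝ) < M := by exact_mod_cast hM
  set p : ℕ → Prop := fun m => Transcendental ℚ (gammaDeriv n (m : ℝ)) with hp
  have hset : {m ∈ lattice M | p m} = ((Finset.Icc 1 M).filter p : Set ℕ) := by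
    ext m
    simp [lattice]
  have hcount : ((Finset.Icc 1 M).filter p).card + ((Finset.Icc 1 M).filter (¬ p ·)).card = M := by
    rw [Finset.card_filter_add_card_filter_not]
    simp
  have hle : ((Finset.Icc 1 M).filter (¬ p ·)).card ≤ M := by omega
  have hlt : ((Finset.Icc 1 M).filter (¬ p ·)).card < n := by
    -- The counting lemma indexes arguments as `m + 1`, hence the shift.
    have hinj : Set.InjOn (fun m : ℕ => m - 1) ((Finset.Icc 1 M).filter (¬ p ·) : Finset ℕ) := by
      intro x hx y hy hxy
      simp only [Finset.coe_filter, Finset.mem_Icc, Set.mem_ofPred_eq] at hx hy hxy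
      omega
    rw [← Finset.card_image_of_injOn hinj]
    refine card_lt_of_forall_isAlgebraic hn fun k hk => ?_
    obtain ⟨m, hm, rfl⟩ := Finset.mem_image.1 hk
    rw [Finset.mem_filter, Finset.mem_Icc] at hm
    rw [Nat.sub_add_cancel hm.1.1]
    exact not_not.1 hm.2
  have hcount' : (((Finset.Icc 1 M).filter p).card : ℝ) =
      M - ((Finset.Icc 1 M).filter (¬ p ·)).card := by
    rw [eq_sub_iff_add_eq]
    exact_mod_cast hcount
  rw [transDensity, hset, Set.ncard_coe_finset, hcount', betaBound, sub_div, div_self hM0.ne']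
  gcongr
  refine le_min ?_ (by exact_mod_cast hle)
  rw [le_sub_iff_add_le]
  exact_mod_cast hlt

theorem betaBound_eventuallyEq (n : ℕ) :
    (fun M : ℕ => betaBound n M) =ᶠ[atTop] fun M : ℕ => 1 - ((n : ℝ) - 1) / (M : ℝ) := by
  filter_upwards [eventually_ge_atTop n] with M hM
  have : (n : ℝ) ≤ M := by exact_mod_cast hM
  rw [betaBound, min_eq_left (by linarith)]

end Density

theorem corollary1 (n : ℕ) (hn : 2 ≤ n) :
    (∀ M : ℕ, 1 ≤ M → betaBound n M ≤ transDensity n M) ∧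
    (fun M : ℕ => betaBound n M) ~[atTop] (fun M : ℕ => 1 - ((n : ℝ) - 1) / (M : ℝ)) ∧
    (fun M : ℕ => betaBound n M) =Θ[atTop] (fun M : ℕ => 1 - ((n : ℝ) - 1) / (M : ℝ)) ∧
    Tendsto (fun M : ℕ => betaBound n M) atTop (𝓝 1) := by
  have hlim : Tendsto (fun M : ℕ => 1 - ((n : ℝ) - 1) / (M : ℝ)) atTop (𝓝 1) := by
    simpa using tendsto_const_nhds.sub (tendsto_const_div_atTop_nhds_zero_nat ((n : ℝ) - 1))
  exact ⟨fun M hM => betaBound_le_transDensity hn hM, (betaBound_eventuallyEq n).isEquivalent,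
    (betaBound_eventuallyEq n).isEquivalent.isTheta, hlim.congr' (betaBound_eventuallyEq n).symm⟩
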